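/- Let $u:\mathbb{C}\to\mathbb{C}$ be an entire function, $u\not\equiv 0$, that solves the Airy equation $u''(z)=z\,u(z)$, and let $U:\mathbb{C}\to\mathbb{C}$ be an antiderivative of $u$, that is, an entire function with $U'=u$. Then the functions $u$, $u'$ and $U$ are algebraically independent over the field $\mathbb{C}(z)$ of rational functions (inside the field of meromorphic functions on $\mathbb{C}$). -/

import Mathlib

open Polynomial nonZeroDivisors

noncomputable section

/-- The ring of entire functions, as a subalgebra of the algebra of all functions `ℂ → ℂ`
(with pointwise operations). -/
def entireFunctions : Subalgebra ℂ (ℂ → ℂ) where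
  carrier := {f | Differentiable ℂ f}
  mul_mem' hf hg := Differentiable.mul hf hg
  add_mem' hf hg := Differentiable.add hf hg
  algebraMap_mem' c := differentiable_const c

theorem mem_entireFunctions {f : ℂ → ℂ} : f ∈ entireFunctions ↔ Differentiable ℂ f := Iff.rfl

/-- The ring of entire functions has no zero divisors (identity theorem). -/
instance entireFunctions.instIsDomain : IsDomain entireFunctions := by
  have : NoZeroDivisors entireFunctions := ⟨by
    rintro ⟨f, hf⟩ ⟨g, hg⟩ h
    rw [mem_entireFunctions] at hf hg
    have hf' : AnalyticOnNhd ℂ f Set.univ := fun z _ => Differentiable.analyticAt hf z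
    have hg' : AnalyticOnNhd ℂ g Set.univ := fun z _ => Differentiable.analyticAt hg z
    have hfg : ∀ z ∈ Set.univ, f z * g z = 0 := fun z _ => congrFun (congrArg Subtype.val h) z
    rcases hf'.eq_zero_or_eq_zero_of_mul_eq_zero hg' hfg isPreconnected_univ with h0 | h0
    · exact Or.inl (Subtype.ext (funext fun z => h0 z trivial))
    · exact Or.inr (Subtype.ext (funext fun z => h0 z trivial))⟩
  exact NoZeroDivisors.to_isDomain _

/-- The field of meromorphic functions on `ℂ`, as the field of quotients of entire functions. -/
def MeromorphicFunctions : Type := FractionRing entireFunctions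

instance MeromorphicFunctions.instField : Field MeromorphicFunctions :=
  inferInstanceAs (Field (FractionRing entireFunctions))

instance MeromorphicFunctions.instAlgebra : Algebra entireFunctions MeromorphicFunctions :=
  inferInstanceAs (Algebra entireFunctions (FractionRing entireFunctions))

instance MeromorphicFunctions.instIsFractionRing :
    IsFractionRing entireFunctions MeromorphicFunctions :=
  inferInstanceAs (IsFractionRing entireFunctions (FractionRing entireFunctions))

/-- A differentiable function `ℂ → ℂ`, as an element of the field of meromorphic functions. -/
def Differentiable.toMeromorphic {f : ℂ → ℂ} (hf : Differentiable ℂ f) : MeromorphicFunctions :=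
  algebraMap entireFunctions MeromorphicFunctions ⟨f, mem_entireFunctions.2 hf⟩

/-- A polynomial `p ∈ ℂ[X]`, as the entire function `z ↦ p(z)`. -/
def polynomialToEntire : ℂ[X] →+* entireFunctions where
  toFun p := ⟨fun z => p.eval z, mem_entireFunctions.2 p.differentiable⟩
  map_one' := by ext z; simp
  map_mul' p q := by ext z; simp
  map_zero' := by ext z; simp
  map_add' p q := by ext z; simp

theorem polynomialToEntire_injective : Function.Injective polynomialToEntire := fun _ _ h =>
  Polynomial.funext fun z => congrFun (congrArg Subtype.val h) z

/-- A polynomial `p ∈ ℂ[X]`, as the meromorphic function `z ↦ p(z)`. -/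
def polynomialToMeromorphic : ℂ[X] →+* MeromorphicFunctions :=
  (algebraMap entireFunctions MeromorphicFunctions).comp polynomialToEntire

theorem polynomialToMeromorphic_injective : Function.Injective polynomialToMeromorphic :=
  (IsFractionRing.injective entireFunctions MeromorphicFunctions).comp
    polynomialToEntire_injective

/-- The inclusion of the field `ℂ(z)` of rational functions into the field of meromorphic functions:
the formal quotient `p / q` is sent to the meromorphic function `z ↦ p(z) / q(z)`. -/
instance MeromorphicFunctions.instAlgebraRatFunc : Algebra (RatFunc ℂ) MeromorphicFunctions :=
  (RatFunc.liftRingHom polynomialToMeromorphic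
    (nonZeroDivisors_le_comap_nonZeroDivisors_of_injective _
      polynomialToMeromorphic_injective)).toAlgebra

end

/-! Put v = u'/u, so that v' = z - v² and u' = vu. It suffices that v, u, U are successively
transcendental over ℂ[z]. A relation of minimal degree at any level, once differentiated, produces
Darboux polynomials, that is, polynomials dividing their own derivative. The heart is
`eq_C_C_of_dvd_riccatiDerivation`: for z' = 1, v' = z - v² the only nonzero ones in ℂ[z][v] are
constants.

For v, a prime factor of the relation would be Darboux (`eval₂_injective_of_riccati`). For u, some
nv with n > 0 would be the logarithmic derivative of a fraction whose reduced numerator and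
denominator are Darboux (`riccatiDerivation_ratio_ne`). For U, u would have an antiderivative in
ℂ(z,v,u); its reduced denominator is Darboux, hence c uⁿ, and comparing coefficients leaves r' + vr
= c with c ≠ 0, which has no polynomial solution (`riccatiDerivation_add_X_mul_ne`).

To find the Darboux polynomials ∑ p_k(z) v^k of degree m in v, put z = t² and q_k = t^k p_k(t²). The
q_k satisfy a linear system whose tridiagonal matrix T is symmetric for positive weights; pairing
the vector of top coefficients with itself forces all q_k to be constant
(`natDegree_eq_zero_of_tridiagonal`). -/

noncomputable section

/-! ### A symmetric tridiagonal system of differential equations -/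

/-- The tridiagonal operator `x ↦ ((k + 1) x_{k+1} + (m + 1 - k) x_{k-1})_k`. -/
def tridiagonal {R : Type*} [CommRing R] (m : ℕ) (x : ℕ → R) : ℕ → R
  | 0 => x 1
  | k + 1 => (k + 2) * x (k + 2) + (m - k) * x k

/-- `tridiagonal m` is symmetric with respect to the weights `k! (m - k)!`. -/
theorem sum_mul_tridiagonal_comm (m : ℕ) (x y : ℕ → ℂ) (hx : x (m + 1) = 0) (hy : y (m + 1) = 0) :
    ∑ k ∈ Finset.range (m + 1), (k.factorial * (m - k).factorial : ℂ) * (y k * tridiagonal m x k) =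
    ∑ k ∈ Finset.range (m + 1), (k.factorial * (m - k).factorial : ℂ) * (x k * tridiagonal m y k) := by
  -- The weights turn both off-diagonal entries joining k and k + 1 into (k+1)! (m-k)!, so the
  -- pairing is a sum over edges, visibly symmetric in x and y. The condition at m + 1 removes the
  -- boundary term.
  have key : ∀ x y : ℕ → ℂ, x (m + 1) = 0 →
      ∑ k ∈ Finset.range (m + 1), (k.factorial * (m - k).factorial : ℂ) *
        (y k * tridiagonal m x k) =
      ∑ k ∈ Finset.range m, ((k + 1).factorial * (m - k).factorial : ℂ) *
        (y k * x (k + 1) + y (k + 1) * x k) := by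
    intro x y hx
    have h1 : ∀ k, tridiagonal m x k = (k + 1) * x (k + 1) +
        (match k with | 0 => 0 | k + 1 => (m - k) * x k) := by
      rintro (_ | k)
      · simp [tridiagonal]
      · simp only [tridiagonal]; push_cast; ring
    simp only [h1, mul_add, Finset.sum_add_distrib]
    congr 1
    · rw [Finset.sum_range_succ, hx]
      simp only [mul_zero, add_zero]
      refine Finset.sum_congr rfl fun k _ => ?_
      rw [Nat.factorial_succ]; push_cast; ring
    · rw [Finset.sum_range_succ']
      simp only [mul_zero, add_zero]
      refine Finset.sum_congr rfl fun k hk => ?_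
      have hk' : k < m := Finset.mem_range.1 hk
      have : m - k = (m - (k + 1)) + 1 := by omega
      rw [this, Nat.factorial_succ (m - (k + 1))]
      have h2 : ((m - (k + 1) : ℕ) : ℂ) = m - (k + 1) := by
        rw [Nat.cast_sub (by omega)]; push_cast; ring
      push_cast [h2]; ring
  rw [key x y hx, key y x hy]
  exact Finset.sum_congr rfl fun k _ => by ring

theorem coeff_tridiagonal (m : ℕ) (q : ℕ → ℂ[X]) (s k : ℕ) :
    (tridiagonal m q k).coeff s = tridiagonal m (fun k => (q k).coeff s) k := by
  have h : ∀ (n : ℕ) (p : ℂ[X]), ((n : ℂ[X]) * p).coeff s = n * p.coeff s := fun n p => by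
    rw [← C_eq_natCast, coeff_C_mul]
  cases k with
  | zero => rfl
  | succ k =>
    simp only [tridiagonal, coeff_add, sub_mul, coeff_sub, add_mul, h]
    have := h 2 (q (k + 2))
    push_cast at this
    rw [this]

theorem tridiagonal_star (m : ℕ) (x : ℕ → ℂ) (k : ℕ) :
    tridiagonal m (fun k => star (x k)) k = star (tridiagonal m x k) := by
  cases k <;> simp [tridiagonal]

/-- A polynomial solution of the system of linear differential equations for
`q_k(t) = t ^ k p_k(t ^ 2)` consists of constants. -/
theorem natDegree_eq_zero_of_tridiagonal (m : ℕ) (q : ℕ → ℂ[X]) (hqm : ∀ k, m < k → q k = 0)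
    (hqX : ∀ k s, s < k → (q k).coeff s = 0) (h : ℂ[X])
    (hq : ∀ k, X * derivative (q k) - (k : ℂ[X]) * q k + 2 * (X ^ 3 * tridiagonal m q k) =
      2 * (X ^ 2 * (expand ℂ 2 h * q k))) (k : ℕ) : (q k).natDegree = 0 := by
  set w := (Finset.range (m + 1)).sup fun k => (q k).natDegree with hw
  have hle : ∀ k, (q k).natDegree ≤ w := by
    intro k
    by_cases hk : k ≤ m
    · exact Finset.le_sup (f := fun k => (q k).natDegree) (Finset.mem_range.2 (by omega))
    · rw [hqm k (by omega)]; simp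
  by_contra hne
  have hwpos : 0 < w := lt_of_lt_of_le (Nat.pos_of_ne_zero hne) (hle k)
  obtain ⟨k₀, -, hk₀⟩ := Finset.exists_mem_eq_sup (Finset.range (m + 1)) ⟨0, by simp⟩
    fun k => (q k).natDegree
  rw [← hw] at hk₀
  have hx₀ : (q k₀).coeff w ≠ 0 := by
    rw [hk₀, coeff_natDegree, Ne, leadingCoeff_eq_zero]
    intro h0
    rw [h0] at hk₀; simp at hk₀; omega
  have hq₀ : q k₀ ≠ 0 := by rintro h0; simp [h0] at hx₀
  -- the cofactor is constant
  obtain ⟨a, rfl⟩ : ∃ a, h = C a := by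
    by_cases hh : h = 0
    · exact ⟨0, by simp [hh]⟩
    refine ⟨h.coeff 0, eq_C_of_natDegree_eq_zero ?_⟩
    have hh' : expand ℂ 2 h ≠ 0 := (expand_ne_zero two_pos).2 hh
    have h1 := congrArg natDegree (hq k₀)
    -- This degree is w + 2 + 2 deg h, while the other side has degree at most w + 3; hence deg h =
    -- 0.
    have h2 : (2 * (X ^ 2 * (expand ℂ 2 h * q k₀))).natDegree = 2 + h.natDegree * 2 + w := by
      have : (2 : ℂ[X]) = C 2 := rfl
      rw [this, natDegree_C_mul two_ne_zero, natDegree_mul (by simp)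
        (mul_ne_zero hh' hq₀), natDegree_mul hh' hq₀,
        natDegree_expand, natDegree_X_pow, hk₀]
      ring
    have h3 : (X * derivative (q k₀) - (k₀ : ℂ[X]) * q k₀ +
        2 * (X ^ 3 * tridiagonal m q k₀)).natDegree ≤ w + 3 := by
      rw [natDegree_le_iff_coeff_eq_zero]
      intro N hN
      have h2C : (2 : ℂ[X]) = C 2 := rfl
      obtain ⟨N, rfl⟩ : ∃ n, N = n + 3 := ⟨N - 3, by omega⟩
      have hz : ∀ n k, w < n → (q k).coeff n = 0 := fun n k hn =>
        coeff_eq_zero_of_natDegree_lt (lt_of_le_of_lt (hle k) hn)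
      rw [coeff_add, coeff_sub, ← C_eq_natCast, coeff_C_mul, h2C, coeff_C_mul, coeff_X_pow_mul,
        coeff_X_mul, coeff_derivative, coeff_tridiagonal, hz _ _ (by omega)]
      have : (fun k => (q k).coeff N) = fun _ => 0 := funext fun k => hz _ _ (by omega)
      rw [this]
      cases k₀ <;> simp [tridiagonal]
    omega
  have hcoeff : ∀ s k : ℕ, ((s : ℂ) - k) * (q k).coeff s +
      2 * (if 3 ≤ s then tridiagonal m (fun k => (q k).coeff (s - 3)) k else 0) =
      2 * (if 2 ≤ s then a * (q k).coeff (s - 2) else 0) := by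
    intro s k
    have h1 := congrArg (fun p => coeff p s) (hq k)
    have h2C : (2 : ℂ[X]) = C 2 := rfl
    have hd : (X * derivative (q k)).coeff s = s * (q k).coeff s := by
      cases s with
      | zero => simp
      | succ s => rw [coeff_X_mul, coeff_derivative]; push_cast; ring
    simp only [coeff_add, coeff_sub, ← C_eq_natCast, h2C, coeff_C_mul, hd, coeff_X_pow_mul',
      coeff_tridiagonal, expand_C] at h1
    rw [← h1]; ring
  set x : ℕ → ℂ := fun k => (q k).coeff w with hxdef
  set β : ℕ → ℂ := fun k => (k.factorial * (m - k).factorial : ℂ) with hβ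
  -- The coefficient of t^(w+3): the top vector x lies in the kernel of T.
  have htri : ∀ k, tridiagonal m x k = 0 := by
    intro k
    have h1 := hcoeff (w + 3) k
    have hz : ∀ n, w < n → (q k).coeff n = 0 := fun n hn =>
        coeff_eq_zero_of_natDegree_lt (lt_of_le_of_lt (hle k) hn)
    simpa [hz (w + 3), hz (w + 1)] using h1
  -- By symmetry the kernel vector x is orthogonal to the whole image of T.
  have hpair : ∀ s, ∑ k ∈ Finset.range (m + 1), β k * (star (x k) *
      tridiagonal m (fun k => (q k).coeff s) k) = 0 := by
    intro s
    rw [hβ, sum_mul_tridiagonal_comm m _ (fun k => star (x k)) (by simp [hqm])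
      (by simp [hxdef, hqm])]
    exact Finset.sum_eq_zero fun k _ => by rw [tridiagonal_star, htri]; simp
  have hnonneg : ∀ c : ℕ → ℝ, (∀ k, x k ≠ 0 → 0 ≤ c k) →
      ∑ k ∈ Finset.range (m + 1), β k * (star (x k) * (c k * x k)) = 0 →
      ∀ k, x k ≠ 0 → c k = 0 := by
    intro c hc hsum k hk
    have hterm : ∀ k, β k * (star (x k) * (c k * x k)) =
        ((k.factorial * (m - k).factorial * (c k * Complex.normSq (x k)) : ℝ) : ℂ) := by
      intro k
      have : star (x k) * x k = (Complex.normSq (x k) : ℂ) := Complex.normSq_eq_conj_mul_self.symm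
      simp only [hβ]
      push_cast
      rw [← this]; ring
    simp only [hterm] at hsum
    rw [← Complex.ofReal_sum, Complex.ofReal_eq_zero, Finset.sum_eq_zero_iff_of_nonneg] at hsum
    · have hkm : k < m + 1 := by
        by_contra hkm
        exact hk (by simp [hxdef, hqm k (by omega)])
      have h1 := hsum k (Finset.mem_range.2 hkm)
      have h2 : Complex.normSq (x k) ≠ 0 := by simpa using hk
      simpa [Nat.factorial_ne_zero, h2, hk] using h1
    · intro k _
      by_cases hk0 : x k = 0
      · simp [hk0]
      · have := hc k hk0
        have := Complex.normSq_nonneg (x k)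
        positivity
  -- The coefficient of t^(w+2) puts a x in the image of T, so a ‖x‖² = 0 in the weighted norm.
  have ha : a = 0 := by
    have h1 : ∑ k ∈ Finset.range (m + 1), β k * (star (x k) * (a * x k)) = 0 := by
      have h2 : ∀ k, a * x k = (if 3 ≤ w + 2 then
          tridiagonal m (fun k => (q k).coeff (w + 2 - 3)) k else 0) := by
        intro k
        have h1 := hcoeff (w + 2) k
        rw [coeff_eq_zero_of_natDegree_lt (lt_of_le_of_lt (hle k) (by omega : w < w + 2))] at h1
        rw [mul_zero, zero_add, if_pos (by omega : 2 ≤ w + 2), Nat.add_sub_cancel] at h1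
        exact (mul_left_cancel₀ two_ne_zero h1).symm
      simp only [h2, if_pos (by omega : 3 ≤ w + 2)]
      exact hpair _
    by_contra ha
    have h3 : ∑ k ∈ Finset.range (m + 1), β k * (star (x k) * (((1 : ℝ) : ℂ) * x k)) = 0 := by
      have : a * ∑ k ∈ Finset.range (m + 1), β k * (star (x k) * (((1 : ℝ) : ℂ) * x k)) = 0 := by
        rw [← h1, Finset.mul_sum]
        exact Finset.sum_congr rfl fun k _ => by push_cast; ring
      exact (mul_eq_zero.1 this).resolve_left ha
    exact one_ne_zero (hnonneg (fun _ => 1) (fun _ _ => zero_le_one) h3 k₀ hx₀)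
  -- The coefficient of t^w puts ((w - k) x_k) in the image of T, so the weighted sum of (w -
  -- k)|x_k|² vanishes. Its terms are nonnegative because t^k divides q_k, which gives k ≤ w on the
  -- support of x.
  have hsupp : ∀ k, x k ≠ 0 → k = w := by
    intro k hk
    have h1 := hnonneg (fun k => (w : ℝ) - k) (fun k hk => by
        have : k ≤ w := by
          by_contra hlt
          exact hk (hqX k w (by omega))
        simpa using this) (by
      have h2 : ∀ k : ℕ, (((w : ℝ) - k : ℝ) : ℂ) * x k = -2 * (if 3 ≤ w then
          tridiagonal m (fun k => (q k).coeff (w - 3)) k else 0) := by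
        intro k
        have h1 := hcoeff w k
        simp only [ha, zero_mul, ite_self, mul_zero] at h1
        push_cast
        linear_combination h1
      simp only [h2]
      split_ifs
      · have := hpair (w - 3)
        have h4 := congrArg (fun t => -2 * t) this
        simp only [Finset.mul_sum, mul_zero] at h4
        rw [← h4]
        exact Finset.sum_congr rfl fun k _ => by ring
      · simp) k hk
    have : (w : ℝ) = k := by linarith
    exact_mod_cast this.symm
  have hk₀w := hsupp k₀ hx₀
  obtain ⟨v, hv⟩ : ∃ v, w = v + 1 := ⟨w - 1, by omega⟩
  -- Row w - 1 of T x = 0 now reads w x_w = 0, which is impossible as w > 0.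
  have h1 := htri v
  have hxw : x (v + 1) ≠ 0 := by rw [← hv, ← hk₀w]; exact hx₀
  rcases v with _ | v
  · exact hxw h1
  · have h0 : x v = 0 := by
      by_contra h0
      have := hsupp v h0
      omega
    simp only [tridiagonal, h0, mul_zero, add_zero, mul_eq_zero, hxw, or_false] at h1
    exact absurd h1 (by exact_mod_cast Nat.succ_ne_zero (v + 1))

/-! ### Extending derivations to polynomial rings -/

/-- The additive derivations of a commutative ring `R` into itself. -/
abbrev SelfDerivation (R : Type*) [CommRing R] : Type _ := Derivation ℤ R R

section Extension

variable {R M : Type*} [CommRing R] [CommRing M]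

/-- The extension of a derivation of `R` to `R[X]` with a prescribed value `g` at `X`. -/
def Derivation.extendPolynomial (d : SelfDerivation R) (g : R[X]) : SelfDerivation R[X] :=
  letI : Differential R := ⟨d⟩
  Differential.implicitDeriv g

variable (d : SelfDerivation R) (g : R[X])

@[simp]
theorem Derivation.extendPolynomial_C (a : R) : d.extendPolynomial g (C a) = C (d a) :=
  letI : Differential R := ⟨d⟩
  Differential.implicitDeriv_C g a

@[simp]
theorem Derivation.extendPolynomial_X : d.extendPolynomial g X = g :=
  letI : Differential R := ⟨d⟩
  Differential.implicitDeriv_X g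

theorem Derivation.coeff_extendPolynomial (p : R[X]) (i : ℕ) :
    (d.extendPolynomial g p).coeff i = d (p.coeff i) + (g * derivative p).coeff i := by
  let : Differential R := ⟨d⟩
  change (Differential.implicitDeriv g p).coeff i = _
  simp only [Differential.implicitDeriv, Derivation.add_apply, coeff_add,
    Differential.coeff_mapCoeffs, Derivation.smul_apply, smul_eq_mul]
  rfl

/-- Both sides are derivations along the evaluation map that agree on constants and on `X`.
Consequently the derivative of a polynomial relation for `w` is again a relation. -/
theorem Derivation.eval₂_extendPolynomial (δ : SelfDerivation M) (φ : R →+* M) (w : M)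
    (hφ : ∀ a, δ (φ a) = φ (d a)) (hw : δ w = g.eval₂ φ w) (p : R[X]) :
    (d.extendPolynomial g p).eval₂ φ w = δ (p.eval₂ φ w) := by
  induction p using Polynomial.induction_on with
  | C a => simp [hφ]
  | add p q hp hq => simp [hp, hq, eval₂_add]
  | monomial n a ih =>
    rw [pow_succ, ← mul_assoc]
    generalize C a * X ^ n = r at ih
    rw [Derivation.leibniz, eval₂_mul, Derivation.leibniz, eval₂_X,
      smul_eq_mul, smul_eq_mul, smul_eq_mul, smul_eq_mul, eval₂_add, eval₂_mul, eval₂_mul, ih,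
      Derivation.extendPolynomial_X, ← hw, eval₂_X]

/-- When `X` has an affine derivative, differentiation does not raise the degree; the arguments by
minimal degree rest on this. -/
theorem Derivation.coeff_extendPolynomial_affine (α β : R) (p : R[X]) (i : ℕ) :
    (d.extendPolynomial (C α * X + C β) p).coeff i =
      d (p.coeff i) + i * α * p.coeff i + (i + 1) * β * p.coeff (i + 1) := by
  have h : (C α * X + C β) * derivative p = C α * (X * derivative p) + C β * derivative p := by ring
  rw [coeff_extendPolynomial, h, coeff_add, coeff_C_mul, coeff_C_mul, coeff_derivative]
  cases i with
  | zero => simp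
  | succ i => rw [coeff_X_mul, coeff_derivative]; push_cast; ring

end Extension

/-! ### Algebraic solutions of first-order linear equations -/

section Transcendence

variable {R M : Type*} [CommRing R] [CommRing M]

theorem exists_minimal_natDegree_eval₂_eq_zero (φ : R →+* M) (w : M)
    (h : ∃ p : R[X], p ≠ 0 ∧ p.eval₂ φ w = 0) :
    ∃ p : R[X], p ≠ 0 ∧ p.eval₂ φ w = 0 ∧
      ∀ r : R[X], r.eval₂ φ w = 0 → r.natDegree < p.natDegree → r = 0 := by
  classical
  let P : ℕ → Prop := fun n => ∃ p : R[X], (p ≠ 0 ∧ p.eval₂ φ w = 0) ∧ p.natDegree = n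
  have hP : ∃ n, P n := let ⟨p, hp⟩ := h; ⟨_, p, hp, rfl⟩
  obtain ⟨p, ⟨hp0, hpw⟩, hpn⟩ := Nat.find_spec hP
  refine ⟨p, hp0, hpw, fun r hr hlt => ?_⟩
  by_contra hr0
  exact Nat.find_min hP (hpn ▸ hlt) ⟨r, ⟨hr0, hr⟩, rfl⟩

/-- A relation between the coefficients of a minimal equation for a solution `w` of the linear
differential equation `w' = α w + β`. -/
theorem exists_minimal_relation (d : SelfDerivation R) (δ : SelfDerivation M)
    (φ : R →+* M) (hφ : ∀ a, δ (φ a) = φ (d a)) (α β : R) (w : M)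
    (hw : δ w = φ α * w + φ β) (h : ∃ p : R[X], p ≠ 0 ∧ p.eval₂ φ w = 0) :
    ∃ p : R[X], p ≠ 0 ∧ p.eval₂ φ w = 0 ∧
      (∀ r : R[X], r.eval₂ φ w = 0 → r.natDegree < p.natDegree → r = 0) ∧
      ∀ k, p.leadingCoeff * (d (p.coeff k) + k * α * p.coeff k + (k + 1) * β * p.coeff (k + 1)) =
        (d p.leadingCoeff + p.natDegree * α * p.leadingCoeff) * p.coeff k := by
  obtain ⟨p, hp0, hpw, hmin⟩ := exists_minimal_natDegree_eval₂_eq_zero φ w h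
  refine ⟨p, hp0, hpw, hmin, ?_⟩
  set n := p.natDegree with hn
  set g : R[X] := C α * X + C β with hg
  set D := d.extendPolynomial g with hD
  -- Eliminating the top term between `D p` and `p` gives a relation of smaller degree, hence zero
  -- by minimality.
  set r := C p.leadingCoeff * D p - C (d p.leadingCoeff + n * α * p.leadingCoeff) * p with hr
  have hcoeff : ∀ k, r.coeff k =
      p.leadingCoeff * (d (p.coeff k) + k * α * p.coeff k + (k + 1) * β * p.coeff (k + 1)) -
        (d p.leadingCoeff + n * α * p.leadingCoeff) * p.coeff k := by
    intro k
    rw [hr, coeff_sub, coeff_C_mul, coeff_C_mul, hD, hg, d.coeff_extendPolynomial_affine]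
  have hrw : r.eval₂ φ w = 0 := by
    have h1 : (D p).eval₂ φ w = 0 := by
      rw [hD, d.eval₂_extendPolynomial g δ φ w hφ (by simp [hg, hw]), hpw, map_zero]
    rw [hr, eval₂_sub, eval₂_mul, eval₂_mul, h1, hpw]; simp
  have hge : ∀ k, n ≤ k → r.coeff k = 0 := by
    intro k hk
    have hz : p.coeff (k + 1) = 0 := coeff_eq_zero_of_natDegree_lt (by omega)
    rcases hk.eq_or_lt with rfl | hk
    · rw [hcoeff, hz, coeff_natDegree]; ring
    · rw [hcoeff, hz, coeff_eq_zero_of_natDegree_lt hk]; simp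
  have hr0 : r = 0 := by
    by_contra hr0
    refine hr0 (hmin r hrw ?_)
    by_contra hlt
    exact hr0 (leadingCoeff_eq_zero.1 (hge _ (not_lt.1 hlt)))
  intro k
  have := hcoeff k
  rw [hr0, coeff_zero] at this
  exact (sub_eq_zero.1 this.symm)

/-- If an antiderivative of `β` is algebraic over `R`, then `β` has an antiderivative in the field
of fractions of `R`. -/
theorem exists_ratio_of_algebraic_antiderivative [IsDomain R] [CharZero R] (d : SelfDerivation R)
    (δ : SelfDerivation M)
    (φ : R →+* M) (hinj : Function.Injective φ) (hφ : ∀ a, δ (φ a) = φ (d a)) (β : R) (w : M)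
    (hw : δ w = φ β) (h : ∃ p : R[X], p ≠ 0 ∧ p.eval₂ φ w = 0) :
    ∃ p q : R, q ≠ 0 ∧ q * d p - p * d q = β * q ^ 2 := by
  obtain ⟨p, hp0, hpw, -, hrel⟩ := exists_minimal_relation d δ φ hφ 0 β w (by simpa using hw) h
  obtain ⟨n, hn⟩ : ∃ n, p.natDegree = n + 1 := by
    refine ⟨p.natDegree - 1, ?_⟩
    suffices p.natDegree ≠ 0 by omega
    intro h0
    rw [eq_C_of_natDegree_eq_zero h0] at hpw hp0
    rw [eval₂_C, map_eq_zero_iff φ hinj] at hpw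
    simp [hpw] at hp0
  have hlead : p.coeff (n + 1) = p.leadingCoeff := by rw [← hn, coeff_natDegree]
  -- Just below the top, with α = 0, the relation says that p_n divided by the leading coefficient
  -- has derivative -(n+1)β.
  have h1 := hrel n
  rw [hlead] at h1
  have hd : d ((n : R) + 1) = 0 := by
    have := d.map_natCast (n + 1)
    push_cast at this
    exact this
  have hne : ((n : R) + 1) ≠ 0 := by exact_mod_cast Nat.succ_ne_zero n
  refine ⟨-p.coeff n, (n + 1) * p.leadingCoeff,
    mul_ne_zero hne (leadingCoeff_ne_zero.2 hp0), ?_⟩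
  rw [Derivation.leibniz, hd, map_neg]
  simp only [smul_eq_mul]
  linear_combination (-(n + 1) : R) * h1

/-- If an exponential of an integral of `α` is algebraic over `R`, then some positive multiple of
`α` is a logarithmic derivative in the field of fractions of `R`. -/
theorem exists_ratio_of_algebraic_exponential (d : SelfDerivation R)
    (δ : SelfDerivation M) [IsDomain M]
    (φ : R →+* M) (hinj : Function.Injective φ) (hφ : ∀ a, δ (φ a) = φ (d a)) (α : R) (w : M)
    (hw0 : w ≠ 0) (hw : δ w = φ α * w) (h : ∃ p : R[X], p ≠ 0 ∧ p.eval₂ φ w = 0) :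
    ∃ (p q : R) (n : ℕ), p ≠ 0 ∧ q ≠ 0 ∧ n ≠ 0 ∧ q * d p - p * d q = n * α * (p * q) := by
  obtain ⟨p, hp0, hpw, hmin, hrel⟩ := exists_minimal_relation d δ φ hφ α 0 w (by simpa using hw) h
  have hn : p.natDegree ≠ 0 := by
    intro h0
    rw [eq_C_of_natDegree_eq_zero h0] at hpw hp0
    rw [eval₂_C, map_eq_zero_iff φ hinj] at hpw
    simp [hpw] at hp0
  refine ⟨p.coeff 0, p.leadingCoeff, p.natDegree, ?_, leadingCoeff_ne_zero.2 hp0, hn, ?_⟩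
  -- With zero constant term, a factor `X` could be cancelled since w ≠ 0, contradicting minimality.
  · intro h0
    obtain ⟨r, rfl⟩ := X_dvd_iff.2 h0
    rw [eval₂_mul, eval₂_X] at hpw
    have hr := hmin r ((mul_eq_zero.1 hpw).resolve_left hw0) (by
      have := φ.domain_nontrivial
      rw [natDegree_X_mul (right_ne_zero_of_mul hp0)]; omega)
    simp [hr] at hp0
  · have := hrel 0
    simp only [Nat.cast_zero, mul_zero, zero_mul, add_zero] at this
    linear_combination this

end Transcendence

/-! ### Reduced fractions and Darboux denominators -/

section Fractions

variable {R : Type*} [CommRing R] [UniqueFactorizationMonoid R]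

/-- In a relation for the derivative of a quotient `p / q`, the quotient may be reduced. -/
theorem exists_isRelPrime_wronskian (d : SelfDerivation R) (p q : R) (hq : q ≠ 0) :
    ∃ p' q' c : R, IsRelPrime p' q' ∧ c * p' = p ∧ c * q' = q ∧ c ≠ 0 ∧ q' ≠ 0 ∧
      q * d p - p * d q = c ^ 2 * (q' * d p' - p' * d q') := by
  obtain ⟨p', q', c, h, hp, hq'⟩ := UniqueFactorizationMonoid.exists_reduced_factors' p q hq
  have hne : c * q' ≠ 0 := hq' ▸ hq
  refine ⟨p', q', c, h, hp, hq', left_ne_zero_of_mul hne, right_ne_zero_of_mul hne, ?_⟩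
  rw [← hp, ← hq', Derivation.leibniz, Derivation.leibniz]
  simp only [smul_eq_mul]
  ring

/-- If `a` has an antiderivative in the field of fractions, then it has one whose denominator is
a Darboux element. -/
theorem exists_darboux_denominator [IsDomain R] (d : SelfDerivation R) (p q a : R) (hq : q ≠ 0)
    (h : q * d p - p * d q = a * q ^ 2) :
    ∃ p' q' l : R, q' ≠ 0 ∧ d q' = q' * l ∧ d p' - p' * l = a * q' := by
  obtain ⟨p', q', c, hrel, rfl, rfl, hc, hq', heq⟩ := exists_isRelPrime_wronskian d p q hq
  replace h : q' * d p' - p' * d q' = a * q' ^ 2 := by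
    apply mul_left_cancel₀ (pow_ne_zero 2 hc)
    rw [← heq, h]; ring
  -- The equation shows that q' divides p' d q', and q' is prime to p'.
  obtain ⟨l, hl⟩ : q' ∣ d q' := by
    refine hrel.symm.dvd_of_dvd_mul_left (y := p') ⟨d p' - a * q', ?_⟩
    linear_combination -h
  refine ⟨p', q', l, hq', hl, ?_⟩
  apply mul_left_cancel₀ hq'
  linear_combination h + p' * hl

end Fractions

/-! ### Darboux polynomials of the Riccati derivation -/

/-- The formal derivative of polynomials, as a derivation over `ℤ`. -/
def formalDerivation : SelfDerivation ℂ[X] := (0 : SelfDerivation ℂ).extendPolynomial 1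

theorem formalDerivation_apply (p : ℂ[X]) : formalDerivation p = derivative p := by
  ext i
  rw [formalDerivation, Derivation.coeff_extendPolynomial, one_mul, Derivation.zero_apply, zero_add]

/-- The derivation of `ℂ[z][v]` with `z' = 1` and `v' = z - v ^ 2`. -/
def riccatiDerivation : SelfDerivation ℂ[X][X] :=
  formalDerivation.extendPolynomial (C X - X ^ 2)

theorem coeff_zero_riccatiDerivation (p : ℂ[X][X]) :
    (riccatiDerivation p).coeff 0 = derivative (p.coeff 0) + X * p.coeff 1 := by
  rw [riccatiDerivation, Derivation.coeff_extendPolynomial]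
  simp [mul_coeff_zero, coeff_derivative, formalDerivation_apply]

theorem coeff_succ_riccatiDerivation (p : ℂ[X][X]) (k : ℕ) :
    (riccatiDerivation p).coeff (k + 1) = derivative (p.coeff (k + 1)) +
      ((k : ℂ[X]) + 2) * X * p.coeff (k + 2) - (k : ℂ[X]) * p.coeff k := by
  have h : (C X - X ^ 2) * derivative p = C X * derivative p - X * (X * derivative p) := by ring
  have h2 : (X * derivative p).coeff k = k * p.coeff k := by
    cases k with
    | zero => simp
    | succ k => rw [coeff_X_mul, coeff_derivative]; push_cast; ring
  rw [riccatiDerivation, Derivation.coeff_extendPolynomial, h, coeff_sub, coeff_C_mul, coeff_X_mul,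
    h2, coeff_derivative]
  rw [formalDerivation_apply]
  push_cast
  ring

theorem riccatiDerivation_C_C (c : ℂ) : riccatiDerivation (C (C c)) = 0 := by
  rw [riccatiDerivation, Derivation.extendPolynomial_C, formalDerivation_apply]
  simp

/-- The term -v² ∂/∂v is the only one that raises the degree in v; this coefficient fixes the linear
part of a Darboux cofactor. -/
theorem coeff_riccatiDerivation_natDegree_succ (p : ℂ[X][X]) :
    (riccatiDerivation p).coeff (p.natDegree + 1) = -(p.natDegree * p.leadingCoeff) := by
  rw [coeff_succ_riccatiDerivation, coeff_eq_zero_of_natDegree_lt (Nat.lt_succ_self _),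
    coeff_eq_zero_of_natDegree_lt (by omega : p.natDegree < p.natDegree + 2), coeff_natDegree]
  simp

theorem coeff_riccatiDerivation_eq_zero (p : ℂ[X][X]) (k : ℕ) (hk : p.natDegree + 1 < k) :
    (riccatiDerivation p).coeff k = 0 := by
  obtain ⟨k, rfl⟩ : ∃ j, k = j + 1 := ⟨k - 1, by omega⟩
  rw [coeff_succ_riccatiDerivation, coeff_eq_zero_of_natDegree_lt (by omega : _ < k + 1),
    coeff_eq_zero_of_natDegree_lt (by omega : _ < k + 2),
    coeff_eq_zero_of_natDegree_lt (by omega : _ < k)]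
  simp

/-- The derivation `riccatiDerivation` has no nonconstant Darboux polynomials. -/
theorem eq_C_C_of_dvd_riccatiDerivation (p : ℂ[X][X]) (hp0 : p ≠ 0)
    (hdvd : p ∣ riccatiDerivation p) : ∃ c : ℂ, p = C (C c) := by
  obtain ⟨h, hh⟩ := hdvd
  set m := p.natDegree with hm
  have hdeg : h.natDegree ≤ 1 := by
    by_cases h0 : h = 0
    · simp [h0]
    have h1 : (riccatiDerivation p).natDegree ≤ m + 1 :=
      natDegree_le_iff_coeff_eq_zero.2 fun N hN => coeff_riccatiDerivation_eq_zero p N hN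
    rw [hh, natDegree_mul hp0 h0] at h1
    omega
  obtain ⟨h₁, h₀, rfl⟩ := exists_eq_X_add_C_of_natDegree_le_one hdeg
  have hmul : p * (C h₁ * X + C h₀) = C h₁ * (X * p) + C h₀ * p := by ring
  have hh₁ : h₁ = -(m : ℂ[X]) := by
    have h1 := coeff_riccatiDerivation_natDegree_succ p
    rw [hh, hmul, coeff_add, coeff_C_mul, coeff_C_mul, coeff_X_mul, coeff_natDegree,
      coeff_eq_zero_of_natDegree_lt (Nat.lt_succ_self _)] at h1
    have h2 := leadingCoeff_ne_zero.2 hp0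
    apply mul_right_cancel₀ h2
    linear_combination h1
  have heq0 : derivative (p.coeff 0) + X * p.coeff 1 = h₀ * p.coeff 0 := by
    rw [← coeff_zero_riccatiDerivation, hh, hmul]
    simp
  have heq1 : ∀ k, derivative (p.coeff (k + 1)) + ((k : ℂ[X]) + 2) * X * p.coeff (k + 2) - (k : ℂ[X]) * p.coeff k =
      -(m : ℂ[X]) * p.coeff k + h₀ * p.coeff (k + 1) := by
    intro k
    rw [← coeff_succ_riccatiDerivation, hh, hmul, coeff_add, coeff_C_mul, coeff_C_mul, coeff_X_mul,
      hh₁]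
  -- The k-th coefficient equation, taken at z = t² and multiplied by 2 t^(k+2), is the k-th
  -- equation of the tridiagonal system.
  have key := natDegree_eq_zero_of_tridiagonal m (fun k => X ^ k * expand ℂ 2 (p.coeff k))
    (fun k hk => by rw [coeff_eq_zero_of_natDegree_lt hk]; simp)
    (fun k s hs => by rw [coeff_X_pow_mul', if_neg (by omega)]) h₀ (by
      rintro (_ | k)
      · have h1 := congrArg (expand ℂ 2) heq0
        simp only [map_add, map_mul, expand_X] at h1
        simp only [tridiagonal, pow_zero, one_mul, derivative_expand]
        push_cast
        linear_combination 2 * X ^ 2 * h1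
      · have h1 := congrArg (expand ℂ 2) (heq1 k)
        simp only [map_add, map_sub, map_mul, map_neg, map_natCast, map_ofNat, expand_X] at h1
        simp only [tridiagonal, derivative_mul, derivative_expand, derivative_X_pow,
          Nat.add_sub_cancel, map_natCast]
        push_cast
        linear_combination 2 * X ^ (k + 3) * h1)
  -- The constant polynomial t^k p_k(t²) has degree k + 2 deg p_k, so only a constant p_0 can be
  -- nonzero.
  have hexp : ∀ k, p.coeff k ≠ 0 → k + (p.coeff k).natDegree * 2 = 0 := by
    intro k hk
    rw [← key k, natDegree_mul (by simp) ((expand_ne_zero two_pos).2 hk), natDegree_X_pow,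
      natDegree_expand]
  refine ⟨(p.coeff 0).coeff 0, ?_⟩
  rw [← eq_C_of_natDegree_eq_zero (p := p.coeff 0), ← eq_C_of_natDegree_eq_zero]
  · have := hexp m (by rw [hm, coeff_natDegree]; exact leadingCoeff_ne_zero.2 hp0)
    omega
  · by_cases h0 : p.coeff 0 = 0
    · simp [h0]
    · have := hexp 0 h0
      omega

/-! ### Consequences for the Riccati equation -/

/-- A solution of the Riccati equation `v' = z - v ^ 2` is transcendental over `ℂ[z]`. -/
theorem eval₂_injective_of_riccati {M : Type*} [CommRing M] [IsDomain M] (δ : SelfDerivation M)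
    (φ : ℂ[X] →+* M) (hinj : Function.Injective φ) (hφ : ∀ a, δ (φ a) = φ (derivative a)) (v : M)
    (hv : δ v = φ X - v ^ 2) : Function.Injective (eval₂RingHom φ v) := by
  rw [injective_iff_map_eq_zero]
  by_contra! hex
  obtain ⟨p, hp, hp0⟩ := hex
  obtain ⟨p, hp0, hp, hmin⟩ := exists_minimal_natDegree_eval₂_eq_zero φ v ⟨p, hp0, hp⟩
  have hconst : ∀ q : ℂ[X][X], q ≠ 0 → q.eval₂ φ v = 0 → q.natDegree ≠ 0 := by
    intro q hq hqv h0
    rw [eq_C_of_natDegree_eq_zero h0] at hqv hq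
    rw [eval₂_C, map_eq_zero_iff φ hinj] at hqv
    simp [hqv] at hq
  -- Elimination of top terms only yields divisibility up to a factor in ℂ[z]; for a prime of
  -- positive degree in v that factor can be dropped.
  obtain ⟨P, hPprime, hPp, hPv⟩ : ∃ P : ℂ[X][X], Prime P ∧ P ∣ p ∧ P.eval₂ φ v = 0 := by
    obtain ⟨f, hf, hassoc⟩ := UniqueFactorizationMonoid.exists_prime_factors p hp0
    have h0 : eval₂RingHom φ v f.prod = 0 := by
      obtain ⟨c, hc⟩ := hassoc.symm
      rw [← hc, map_mul, coe_eval₂RingHom, hp, zero_mul]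
    rw [map_multiset_prod, Multiset.prod_eq_zero_iff, Multiset.mem_map] at h0
    obtain ⟨P, hPf, hPv⟩ := h0
    exact ⟨P, hf P hPf, (Multiset.dvd_prod hPf).trans hassoc.dvd, hPv⟩
  have hPdeg := hconst P hPprime.ne_zero hPv
  have hle := natDegree_le_of_dvd hPp hp0
  set m := P.natDegree with hm
  -- The added term cancels the coefficient of v^(m+1), so Q has degree at most m and still vanishes
  -- at v.
  set Q := riccatiDerivation P + (m : ℂ[X][X]) * (X * P) with hQ
  have hQv : Q.eval₂ φ v = 0 := by
    rw [hQ, eval₂_add, eval₂_mul, eval₂_mul, hPv, riccatiDerivation,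
      Derivation.eval₂_extendPolynomial _ _ δ φ v
      (fun a => by rw [hφ, formalDerivation_apply]) (by simp [hv]), hPv]
    simp
  have hcoeff : ∀ k, (Q.coeff (k + 1)) = (riccatiDerivation P).coeff (k + 1) + m * P.coeff k := by
    intro k
    rw [hQ, coeff_add, ← C_eq_natCast, coeff_C_mul, coeff_X_mul]
  set r := C P.leadingCoeff * Q - C (Q.coeff m) * P with hr
  have hr0 : r = 0 := by
    by_contra hr0
    refine hr0 (hmin r (by simp [hr, eval₂_sub, eval₂_mul, hQv, hPv]) ?_)
    refine lt_of_lt_of_le ?_ hle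
    by_contra hlt
    refine hr0 (leadingCoeff_eq_zero.1 ?_)
    rw [leadingCoeff]
    have : m ≤ r.natDegree := not_lt.1 hlt
    generalize r.natDegree = n at this
    rw [hr, coeff_sub, coeff_C_mul, coeff_C_mul]
    obtain rfl | hlt := this.eq_or_lt
    · rw [coeff_natDegree]; ring
    obtain ⟨n, rfl⟩ : ∃ j, n = j + 1 := ⟨n - 1, by omega⟩
    rw [hcoeff, coeff_eq_zero_of_natDegree_lt hlt]
    obtain rfl | hlt := (Nat.lt_succ_iff.1 hlt).eq_or_lt
    · rw [coeff_riccatiDerivation_natDegree_succ, coeff_natDegree]; ring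
    · rw [coeff_riccatiDerivation_eq_zero P _ (by omega), coeff_eq_zero_of_natDegree_lt hlt]
      simp
  have hdvd : P ∣ C P.leadingCoeff * Q := ⟨C (Q.coeff m), by rw [sub_eq_zero.1 hr0]; ring⟩
  rcases hPprime.dvd_or_dvd hdvd with h | h
  · have := natDegree_le_of_dvd h (by simpa using hPprime.ne_zero)
    rw [natDegree_C] at this
    omega
  · rw [hQ, dvd_add_left (Dvd.intro_left _ (by ring : ((m : ℂ[X][X]) * X) * P = _))] at h
    obtain ⟨c, hc⟩ := eq_C_C_of_dvd_riccatiDerivation P hPprime.ne_zero h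
    exact hPdeg (by rw [hm, hc, natDegree_C])

/-- After reduction, numerator and denominator divide their own derivatives, hence are constants,
and the left side vanishes while the right side does not. -/
theorem riccatiDerivation_ratio_ne (p q : ℂ[X][X]) (n : ℕ) (hp : p ≠ 0) (hq : q ≠ 0) (hn : n ≠ 0) :
    q * riccatiDerivation p - p * riccatiDerivation q ≠ (n : ℂ[X][X]) * X * (p * q) := by
  intro h
  obtain ⟨p', q', c, hrel, rfl, rfl, hc, hq', heq⟩ := exists_isRelPrime_wronskian
    riccatiDerivation p q hq
  have hp' : p' ≠ 0 := right_ne_zero_of_mul hp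
  have h1 : q' * riccatiDerivation p' - p' * riccatiDerivation q' = (n : ℂ[X][X]) * X * (p' * q') := by
    apply mul_left_cancel₀ (pow_ne_zero 2 hc)
    exact heq.symm.trans (h.trans (by ring))
  have hqd : q' ∣ riccatiDerivation q' := by
    refine hrel.symm.dvd_of_dvd_mul_left (y := p') ⟨riccatiDerivation p' - (n : ℂ[X][X]) * X * p', ?_⟩
    linear_combination -h1
  have hpd : p' ∣ riccatiDerivation p' := by
    refine hrel.dvd_of_dvd_mul_left (y := q') ⟨riccatiDerivation q' + (n : ℂ[X][X]) * X * q', ?_⟩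
    linear_combination h1
  obtain ⟨a, ha⟩ := eq_C_C_of_dvd_riccatiDerivation _ hp' hpd
  obtain ⟨b, hb⟩ := eq_C_C_of_dvd_riccatiDerivation _ hq' hqd
  rw [ha, hb, riccatiDerivation_C_C, riccatiDerivation_C_C, ← ha, ← hb] at h1
  have hn' : (n : ℂ[X][X]) ≠ 0 := by exact_mod_cast hn
  exact mul_ne_zero (mul_ne_zero hn' X_ne_zero) (mul_ne_zero hp' hq') (by rw [← h1]; ring)

/-- The inhomogeneous Riccati-type equation `r' + v r = c` has no solution in `ℂ[z][v]` unless
`c = 0`. -/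
theorem riccatiDerivation_add_X_mul_ne (r : ℂ[X][X]) (c : ℂ) (hc : c ≠ 0) :
    riccatiDerivation r + X * r ≠ C (C c) := by
  intro h
  have h0 : derivative (r.coeff 0) + X * r.coeff 1 = C c := by
    have := congrArg (fun p => coeff p 0) h
    simpa [coeff_zero_riccatiDerivation] using this
  have h1 : ∀ k, derivative (r.coeff (k + 1)) + ((k : ℂ[X]) + 2) * X * r.coeff (k + 2) - (k : ℂ[X]) * r.coeff k +
      r.coeff k = 0 := by
    intro k
    have := congrArg (fun p => coeff p (k + 1)) h
    simpa [coeff_succ_riccatiDerivation, coeff_C_succ] using this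
  -- For r of degree n ≥ 2 in v, the coefficient of v^(n+1) would be 1 - n times the leading
  -- coefficient.
  have hdeg : r.natDegree < 2 := by
    by_contra hlt
    have h2 := h1 r.natDegree
    rw [coeff_eq_zero_of_natDegree_lt (Nat.lt_succ_self _),
      coeff_eq_zero_of_natDegree_lt (by omega : r.natDegree < r.natDegree + 2),
      coeff_natDegree] at h2
    obtain ⟨k, hk⟩ : ∃ k, r.natDegree = k + 2 := ⟨r.natDegree - 2, by omega⟩
    have h3 : ((k + 1 : ℕ) : ℂ[X]) * r.leadingCoeff = 0 := by
      rw [hk] at h2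
      push_cast at h2 ⊢
      simp only [derivative_zero] at h2
      linear_combination -h2
    rcases mul_eq_zero.1 h3 with h4 | h4
    · exact absurd h4 (by exact_mod_cast Nat.succ_ne_zero k)
    · rw [leadingCoeff_eq_zero] at h4
      simp [h4] at hk
  have h2 := h1 0
  rw [coeff_eq_zero_of_natDegree_lt hdeg] at h2
  set s := r.coeff 1 with hs
  have h3 : r.coeff 0 = -derivative s := by
    simp only [Nat.cast_zero, zero_mul, mul_zero, add_zero, sub_zero, zero_add] at h2
    linear_combination h2
  -- What remains is zs - s'' = c; the term zs has the highest degree, so s = 0 and then c = 0.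
  have h4 := congrArg (fun p => coeff p (s.natDegree + 1)) h0
  simp only [h3, coeff_add, coeff_X_mul, coeff_natDegree, coeff_C_succ, derivative_neg, coeff_neg,
    coeff_derivative, coeff_eq_zero_of_natDegree_lt
      (by omega : s.natDegree < s.natDegree + 1 + 1 + 1), zero_mul, neg_zero, zero_add] at h4
  rw [leadingCoeff_eq_zero] at h4
  rw [h3, h4] at h0
  simp only [derivative_zero, neg_zero, mul_zero, add_zero] at h0
  exact hc (C_eq_zero.1 h0.symm)

/-! ### Antiderivatives of u in ℂ(z,v,u) -/

/-- The derivation of `ℂ[z][v][u]` with `z' = 1`, `v' = z - v ^ 2` and `u' = v u`. -/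
def airyDerivation : SelfDerivation ℂ[X][X][X] :=
  riccatiDerivation.extendPolynomial (C X * X)

theorem coeff_airyDerivation (p : ℂ[X][X][X]) (k : ℕ) :
    (airyDerivation p).coeff k = riccatiDerivation (p.coeff k) + (k : ℂ[X][X]) * X * p.coeff k := by
  have := riccatiDerivation.coeff_extendPolynomial_affine X 0 p k
  rw [C_0, add_zero] at this
  rw [airyDerivation, this]
  ring

/-- The variable `X` is u. A Darboux denominator must be c uⁿ, and then the coefficient of u^(n+1)
gives an unsolvable equation in ℂ[z][v]. -/
theorem airyDerivation_ratio_ne (p q : ℂ[X][X][X]) (hq : q ≠ 0) :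
    q * airyDerivation p - p * airyDerivation q ≠ X * q ^ 2 := by
  intro h
  obtain ⟨p', q', l, hq', hl, h1⟩ := exists_darboux_denominator airyDerivation p q X hq h
  -- Differentiation does not raise the degree in u, so the cofactor is free of u.
  obtain ⟨l, rfl⟩ : ∃ a, l = C a := by
    refine ⟨l.coeff 0, eq_C_of_natDegree_eq_zero ?_⟩
    by_cases hl0 : l = 0
    · simp [hl0]
    have h1 : (airyDerivation q').natDegree ≤ q'.natDegree :=
      natDegree_le_iff_coeff_eq_zero.2 fun N hN => by
        rw [coeff_airyDerivation, coeff_eq_zero_of_natDegree_lt hN]; simp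
    rw [hl, natDegree_mul hq' hl0] at h1
    omega
  have hk : ∀ k, riccatiDerivation (q'.coeff k) + (k : ℂ[X][X]) * X * q'.coeff k = q'.coeff k * l := by
    intro k
    rw [← coeff_airyDerivation, hl, coeff_mul_C]
  -- Each nonzero coefficient is a Darboux polynomial of the Riccati derivation, hence constant; its
  -- equation then gives l = kv.
  have hconst : ∀ k, q'.coeff k ≠ 0 → ∃ c : ℂ, c ≠ 0 ∧ q'.coeff k = C (C c) ∧ l = (k : ℂ[X][X]) * X := by
    intro k hk0
    obtain ⟨c, hc⟩ := eq_C_C_of_dvd_riccatiDerivation (q'.coeff k) hk0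
      ⟨l - (k : ℂ[X][X]) * X, by linear_combination hk k⟩
    refine ⟨c, ?_, hc, ?_⟩
    · rintro rfl
      simp [hc] at hk0
    · have h1 := hk k
      rw [hc, riccatiDerivation_C_C, ← hc] at h1
      apply mul_left_cancel₀ hk0
      linear_combination -h1
  set n := q'.natDegree with hn
  obtain ⟨c, hc0, hcn, hln⟩ := hconst n (by rw [hn, coeff_natDegree]; simpa using hq')
  -- With l = nv, the terms (n+1)v and -nv combine, leaving r' + vr = c for r the coefficient of
  -- u^(n+1) in p'.
  have h2 := congrArg (fun p => coeff p (n + 1)) h1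
  simp only [coeff_sub, coeff_mul_C, coeff_X_mul, coeff_airyDerivation, hcn, hln] at h2
  refine riccatiDerivation_add_X_mul_ne (p'.coeff (n + 1)) c hc0 ?_
  rw [← h2]; push_cast; ring

/-! ### Assembling the tower v, u, U -/

section Independence

theorem injective_eval₂RingHom {R M : Type*} [CommRing R] [CommRing M] (φ : R →+* M)
    (w : M) (h : ¬ ∃ p : R[X], p ≠ 0 ∧ p.eval₂ φ w = 0) :
    Function.Injective (eval₂RingHom φ w) := by
  rw [injective_iff_map_eq_zero]
  exact fun p hp => by_contra fun hp0 => h ⟨p, hp0, hp⟩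

/-- If `v`, `u`, `U` are algebraically independent (successively transcendental), then so are
`u`, `v u`, `U`. -/
theorem injective_eval₂Hom_of_tower {A M : Type*} [CommRing A] [IsDomain A]
    [CommRing M] (φ : A →+* M) (u v U : M) (h : Function.Injective
      (eval₂RingHom (eval₂RingHom (eval₂RingHom φ v) u) U)) :
    Function.Injective (MvPolynomial.eval₂Hom φ ![u, v * u, U]) := by
  let Φ : MvPolynomial (Fin 3) A →+* A[X][X][X] :=
    MvPolynomial.eval₂Hom (S₁ := A[X][X][X]) ((C : A[X][X] →+* A[X][X][X]).comp ((C : A[X] →+* A[X][X]).comp C))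
      ![C X, C (C X * X), X]
  have hcomp : MvPolynomial.eval₂Hom φ ![u, v * u, U] =
      (eval₂RingHom (eval₂RingHom (eval₂RingHom φ v) u) U).comp Φ := by
    refine MvPolynomial.ringHom_ext (fun a => ?_) fun i => ?_
    · simp [Φ]
    · fin_cases i <;> simp [Φ]
  -- The substitution (u, v) ↦ (u, vu) is birational: θ inverts it in the fraction field by sending
  -- v to the quotient of the second variable by the first.
  have hΦ : Function.Injective Φ := by
    let K := FractionRing (MvPolynomial (Fin 3) A)
    let ι : MvPolynomial (Fin 3) A →+* K := algebraMap _ _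
    have hι : Function.Injective ι := IsFractionRing.injective _ _
    let θ : A[X][X][X] →+* K := eval₂RingHom (eval₂RingHom (eval₂RingHom (ι.comp MvPolynomial.C)
      (ι (MvPolynomial.X 1) / ι (MvPolynomial.X 0))) (ι (MvPolynomial.X 0))) (ι (MvPolynomial.X 2))
    have hX : ι (MvPolynomial.X 0) ≠ 0 := by
      rw [Ne, map_eq_zero_iff ι hι]
      exact MvPolynomial.X_ne_zero 0
    have hθ : θ.comp Φ = ι := by
      refine MvPolynomial.ringHom_ext (fun a => ?_) fun i => ?_
      · simp [Φ, θ]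
      · fin_cases i <;> simp [Φ, θ, div_mul_cancel₀ _ hX]
    rw [← hθ, RingHom.coe_comp] at hι
    exact hι.of_comp
  rw [hcomp, RingHom.coe_comp]
  exact h.comp hΦ

variable {M : Type*} [Field M]

/-- Algebraic independence over `ℂ[z]` of a solution of the Airy equation in a differential field,
its derivative and its antiderivative. -/
theorem injective_eval₂Hom_airy (δ : SelfDerivation M) (φ : ℂ[X] →+* M)
    (hinj : Function.Injective φ) (hφ : ∀ a, δ (φ a) = φ (derivative a)) (u u' U : M) (hu0 : u ≠ 0)
    (hu : δ u = u') (hu' : δ u' = φ X * u) (hU : δ U = u) :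
    Function.Injective (MvPolynomial.eval₂Hom φ ![u, u', U]) := by
  set v := u' / u with hv
  have hvu : u' = v * u := by rw [hv, div_mul_cancel₀ _ hu0]
  have hδv : δ v = φ X - v ^ 2 := by
    have h1 := hu'
    rw [hvu, Derivation.leibniz, hu, hvu, smul_eq_mul, smul_eq_mul] at h1
    apply mul_right_cancel₀ hu0
    linear_combination h1
  set φ₁ := eval₂RingHom φ v with hφ₁
  have inj₁ : Function.Injective φ₁ := eval₂_injective_of_riccati δ φ hinj hφ v hδv
  have comm₁ : ∀ a, δ (φ₁ a) = φ₁ (riccatiDerivation a) := fun a =>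
    (Derivation.eval₂_extendPolynomial formalDerivation _ δ φ v
      (fun a => by rw [hφ, formalDerivation_apply]) (by simp [hδv]) a).symm
  have hφ₁X : φ₁ X = v := eval₂_X _ _
  set φ₂ := eval₂RingHom φ₁ u with hφ₂
  have inj₂ : Function.Injective φ₂ := by
    refine injective_eval₂RingHom φ₁ u fun hex => ?_
    obtain ⟨r, s, n, hr, hs, hn, h⟩ := exists_ratio_of_algebraic_exponential riccatiDerivation δ φ₁
      inj₁ comm₁ X u hu0 (by rw [hu, hφ₁X, hvu]) hex
    exact riccatiDerivation_ratio_ne r s n hr hs hn h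
  have comm₂ : ∀ a, δ (φ₂ a) = φ₂ (airyDerivation a) := fun a =>
    (Derivation.eval₂_extendPolynomial riccatiDerivation _ δ φ₁ u comm₁
      (by rw [hu, eval₂_mul, eval₂_C, eval₂_X, hφ₁X, hvu]) a).symm
  have hφ₂X : φ₂ X = u := eval₂_X _ _
  set φ₃ := eval₂RingHom φ₂ U with hφ₃
  have inj₃ : Function.Injective φ₃ := by
    refine injective_eval₂RingHom (R := ℂ[X][X][X]) φ₂ U fun hex => ?_
    obtain ⟨r, s, hs, h⟩ := exists_ratio_of_algebraic_antiderivative airyDerivation δ φ₂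
      inj₂ comm₂ X U (by rw [hU, hφ₂X]) hex
    exact airyDerivation_ratio_ne r s hs h
  rw [hvu]
  exact injective_eval₂Hom_of_tower φ u v U inj₃

end Independence

/-! ### Differentiating meromorphic functions and clearing denominators -/

/-- A derivation of a domain extends to its field of fractions. -/
theorem SelfDerivation.exists_extension_fractionRing {A K : Type*} [CommRing A] [IsDomain A]
    [Field K]
    [Algebra A K] [IsFractionRing A K] (d : SelfDerivation A) :
    ∃ δ : SelfDerivation K, ∀ a, δ (algebraMap A K a) = algebraMap A K (d a) := by
  -- A derivation is a ring homomorphism a ↦ a + ε d(a) to the dual numbers. Nonzero elements become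
  -- units because their first component does, so it extends to K, and the ε-part is the extended
  -- derivation.
  let f : A →+* TrivSqZeroExt K K :=
    { toFun a := TrivSqZeroExt.inl (algebraMap A K a) + TrivSqZeroExt.inr (algebraMap A K (d a))
      map_one' := by ext <;> simp
      map_mul' a b := by
        ext <;> simp [-DualNumber.inr_eq_smul_eps, mul_comm]
      map_zero' := by ext <;> simp
      map_add' a b := by ext <;> simp [-DualNumber.inr_eq_smul_eps] }
  have hf : ∀ y : A⁰, IsUnit (f y) := fun y => by
    rw [TrivSqZeroExt.isUnit_iff_isUnit_fst]
    simp [f]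
  let F : K →+* TrivSqZeroExt K K := IsLocalization.lift hf
  have hF : ∀ a, F (algebraMap A K a) = f a := fun a => IsLocalization.lift_eq hf a
  have hfst : ∀ x, (F x).fst = x := by
    have : ((TrivSqZeroExt.fstHom K K K : TrivSqZeroExt K K →+* K)).comp F = RingHom.id K := by
      refine IsLocalization.ringHom_ext A⁰ (RingHom.ext fun a => ?_)
      simp [hF, f]
    exact fun x => RingHom.congr_fun this x
  let D : K →+ K :=
    { toFun x := (F x).snd
      map_zero' := by simp
      map_add' x y := by simp }
  refine ⟨Derivation.mk' D.toIntLinearMap fun x y => ?_, fun a => ?_⟩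
  · change (F (x * y)).snd = x * (F y).snd + y * (F x).snd
    rw [map_mul, TrivSqZeroExt.snd_mul, hfst, hfst]
    simp [mul_comm]
  · change (F (algebraMap A K a)).snd = _
    simp [hF, f, -DualNumber.inr_eq_smul_eps]

/-- Differentiation of entire functions. -/
def entireDerivation : SelfDerivation entireFunctions :=
  Derivation.mk' (AddMonoidHom.toIntLinearMap
    { toFun f := ⟨deriv f.1, mem_entireFunctions.2 (mem_entireFunctions.1 f.2).deriv⟩
      map_zero' := Subtype.ext (by ext z; simp)
      map_add' f g := Subtype.ext (by
        ext z
        exact deriv_add (mem_entireFunctions.1 f.2 z) (mem_entireFunctions.1 g.2 z)) })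
    fun f g => Subtype.ext (by
      ext z
      have := deriv_mul (mem_entireFunctions.1 f.2 z) (mem_entireFunctions.1 g.2 z)
      change deriv (f.1 * g.1) z = f.1 z * deriv g.1 z + g.1 z * deriv f.1 z
      rw [this]; ring)

theorem entireDerivation_apply (f : entireFunctions) (z : ℂ) :
    (entireDerivation f).1 z = deriv f.1 z := rfl

theorem entireDerivation_polynomialToEntire (p : ℂ[X]) :
    entireDerivation (polynomialToEntire p) = polynomialToEntire (derivative p) := by
  refine Subtype.ext (funext fun z => ?_)
  rw [entireDerivation_apply]
  exact p.deriv

/-- Injectivity of a ring homomorphism on polynomials over a field of fractions can be tested on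
polynomials with integral coefficients. -/
theorem injective_of_comp_map_fractionRing {σ A K M : Type*} [CommRing A] [IsDomain A]
    [Field K] [Algebra A K] [IsFractionRing A K] [CommRing M] (f : MvPolynomial σ K →+* M)
    (hf : Function.Injective (f.comp (
      MvPolynomial.map (algebraMap A K)))) :
    Function.Injective f := by
  rw [injective_iff_map_eq_zero]
  intro x hx
  let _ : Algebra (MvPolynomial σ A) (MvPolynomial σ K) := MvPolynomial.algebraMvPolynomial
  -- Polynomials over K are the localization of polynomials over A at the nonzero constants, so `s`
  -- is a common denominator of the coefficients.
  obtain ⟨⟨y, s⟩, hs⟩ := IsLocalization.surj (A⁰.map (MvPolynomial.C (σ := σ) (R := A))) x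
  have hy : y = 0 := by
    apply hf
    have h1 := congrArg f hs
    rw [map_mul, hx, zero_mul] at h1
    rw [map_zero]
    exact h1.symm
  have hu := IsLocalization.map_units (MvPolynomial σ K) s
  rw [hy, map_zero] at hs
  exact hu.mul_left_eq_zero.1 hs

end

/-- If `u ≠ 0` is an entire solution of the Airy equation `u'' = z u` and `U' = u`, then
`u`, `u'`, `U` are algebraically independent over `ℂ(z)`. -/
theorem theorem1 (u U : ℂ → ℂ) (hu : Differentiable ℂ u) (hu0 : u ≠ 0)
    (hAiry : ∀ z : ℂ, deriv (deriv u) z = z * u z)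
    (hU : Differentiable ℂ U) (hUu : ∀ z : ℂ, deriv U z = u z) :
    AlgebraicIndependent (RatFunc ℂ)
      ![hu.toMeromorphic, hu.deriv.toMeromorphic, hU.toMeromorphic] := by
  obtain ⟨δ, hδ⟩ := entireDerivation.exists_extension_fractionRing (K := MeromorphicFunctions)
  have hinj := IsFractionRing.injective entireFunctions MeromorphicFunctions
  refine injective_of_comp_map_fractionRing (A := ℂ[X]) (K := RatFunc ℂ) (MvPolynomial.aeval
    ![hu.toMeromorphic, hu.deriv.toMeromorphic, hU.toMeromorphic]).toRingHom ?_
  convert! injective_eval₂Hom_airy δ polynomialToMeromorphic polynomialToMeromorphic_injective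
    (fun a => ?_) hu.toMeromorphic hu.deriv.toMeromorphic hU.toMeromorphic ?_ ?_ ?_ ?_
  · refine MvPolynomial.ringHom_ext (fun a => ?_) fun i => ?_
    · simp only [AlgHom.toRingHom_eq_coe, RingHom.coe_comp, RingHom.coe_coe, Function.comp_apply,
        MvPolynomial.map_C, MvPolynomial.aeval_C, MvPolynomial.coe_eval₂Hom, MvPolynomial.eval₂_C]
      exact RatFunc.liftRingHom_algebraMap polynomialToMeromorphic
        (nonZeroDivisors_le_comap_nonZeroDivisors_of_injective _
          polynomialToMeromorphic_injective) a
    · simp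
  · exact (hδ _).trans (congrArg _ (entireDerivation_polynomialToEntire a))
  · rw [Differentiable.toMeromorphic, Ne, map_eq_zero_iff _ hinj]
    exact fun h => hu0 (congrArg Subtype.val h)
  · exact hδ _
  · rw [Differentiable.toMeromorphic, hδ, polynomialToMeromorphic, RingHom.comp_apply,
      Differentiable.toMeromorphic, ← map_mul]
    refine congrArg _ (Subtype.ext (funext fun z => ?_))
    rw [entireDerivation_apply, hAiry]
    change z * u z = (X : ℂ[X]).eval z * u z
    rw [eval_X]
  · exact (hδ _).trans (congrArg _ (Subtype.ext (funext hUu)))
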